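/- Let $\mathbb K$ be a field and let $\nu:\mathbb K[x]\to\Gamma\cup\{\infty\}$ be a valuation with values in a totally ordered abelian group $\Gamma$ (that is, $\nu(fg)=\nu(f)+\nu(g)$, $\nu(f+g)\ge\min\{\nu(f),\nu(g)\}$, $\nu(1)=0$, $\nu(0)=\infty$; non-zero polynomials may have value $\infty$). Fix an algebraic closure $\overline{\mathbb K}$ of $\mathbb K$ and a valuation $\overline\nu$ on $\overline{\mathbb K}[x]$ extending $\nu$, with values in a totally ordered abelian group containing $\Gamma$, together with $\infty$. For a non-constant polynomial $f$ put $\delta(f)=\max\{\overline\nu(x-a)\mid a\in\overline{\mathbb K},\ f(a)=0\}$, and put $\delta(f)=-\infty$ for a non-zero constant $f$. A monic polynomial $Q\in\mathbb K[x]$ is a *key polynomial* for $\nu$ if $\deg f\ge\deg Q$ for every non-zero $f\in\mathbb K[x]$ with $\delta(f)\ge\delta(Q)$. For a non-constant $q\in\mathbb K[x]$, the *truncation* of $\nu$ at $q$ is $\nu_q(f)=\min_{0\le i\le s}\nu(f_iq^i)$, where $f=f_0+f_1q+\dots+f_sq^s$ with $\deg f_i<\deg q$ for all $i$. For a valuation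 $\mu$ on $\mathbb K[x]$ let $$\mathcal G_\mu=\bigoplus_{\gamma}\{f\mid\mu(f)\ge\gamma\}/\{f\mid\mu(f)>\gamma\}$$ be its associated graded ring, where $\gamma$ runs over the finite values of $\mu$, and let $\mathrm{in}_\mu(f)\in\mathcal G_\mu$ be the class of $f$ in the component of degree $\mu(f)$, with $\mathrm{in}_\mu(f)=0$ if $\mu(f)=\infty$. When $\nu_q$ is a valuation, write $\mathcal G_q=\mathcal G_{\nu_q}$ and $\mathrm{in}_q=\mathrm{in}_{\nu_q}$, and let $R_q$ be the additive subgroup of $\mathcal G_q$ generated by $\{\mathrm{in}_q(f)\mid \deg f<\deg q\}$. Let $n\in\mathbb N$ and let $\Psi_n$ be the set of key polynomials for $\nu$ of degree $n$, preordered by $Q\preceq Q'$ if and only if $\nu_Q(f)\le\nu_{Q'}(f)$ for all $f\in\mathbb K[x]$. Assume that $\Psi_n\ne\emptyset$ and that $\{\nu(Q)\mid Q\in\Psi_n\}$ has no maximal element. Let $Q_n$ be a limit key polynomial for $\Psi_n$, i.e. a monic polynomial of least degree in the set $\{f\in\mathbb K[x]\mid\nu_Q(f)<\nu(f)\text{ for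 all }Q\in\Psi_n\}$. Then $\nu_Q$ (for every $Q\in\Psi_n$) and $\nu_{Q_n}$ are valuations on $\mathbb K[x]$; $(\Psi_n,\preceq)$ is directed; the rings $\mathcal G_Q$, $Q\in\Psi_n$, form a direct system of rings with the graded homomorphisms $\phi_{QQ'}:\mathcal G_Q\to\mathcal G_{Q'}$ ($Q\preceq Q'$) that send $\mathrm{in}_Q(f)$ to $\mathrm{in}_{Q'}(f)$ if $\nu_Q(f)=\nu_{Q'}(f)$ and to $0$ if $\nu_Q(f)<\nu_{Q'}(f)$; $R_{Q_n}$ is a subring of $\mathcal G_{Q_n}$; and $$\varinjlim_{Q\in\Psi_n}\mathcal G_Q\;\cong\;R_{Q_n}$$ as commutative rings with unity. -/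

import Mathlib

open Polynomial

noncomputable section

namespace KeyPoly

/-! ### The graded ring of a valuation -/

section Graded

variable {R Γ : Type*} [CommRing R] [AddCommGroup Γ] [LinearOrder Γ] [IsOrderedAddMonoid Γ]

/-- `𝒫_γ = {f | v f ≥ γ}`. -/
def geSubgroup (v : AddValuation R (WithTop Γ)) (γ : Γ) : AddSubgroup R where
  carrier := {f | (γ : WithTop Γ) ≤ v f}
  zero_mem' := by simp
  add_mem' := fun {a b} ha hb => le_trans (le_min ha hb) (v.map_add a b)
  neg_mem' := fun {a} ha => by simpa [AddValuation.map_neg] using ha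

/-- `𝒫_γ⁺ = {f | v f > γ}`. -/
def gtSubgroup (v : AddValuation R (WithTop Γ)) (γ : Γ) : AddSubgroup R where
  carrier := {f | (γ : WithTop Γ) < v f}
  zero_mem' := by simp
  add_mem' := fun {a b} ha hb => lt_of_lt_of_le (lt_min ha hb) (v.map_add a b)
  neg_mem' := fun {a} ha => by simpa [AddValuation.map_neg] using ha

theorem mem_geSubgroup {v : AddValuation R (WithTop Γ)} {γ : Γ} {f : R} :
    f ∈ geSubgroup v γ ↔ (γ : WithTop Γ) ≤ v f := Iff.rfl

theorem mem_gtSubgroup {v : AddValuation R (WithTop Γ)} {γ : Γ} {f : R} :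
    f ∈ gtSubgroup v γ ↔ (γ : WithTop Γ) < v f := Iff.rfl

/-- The homogeneous component `𝒫_γ / 𝒫_γ⁺`. -/
abbrev Piece (v : AddValuation R (WithTop Γ)) (γ : Γ) : Type _ :=
  geSubgroup v γ ⧸ (gtSubgroup v γ).addSubgroupOf (geSubgroup v γ)

/-- The class of `f ∈ 𝒫_γ` in `𝒫_γ / 𝒫_γ⁺`. -/
def Piece.mk (v : AddValuation R (WithTop Γ)) {γ : Γ} (f : R) (hf : (γ : WithTop Γ) ≤ v f) :
    Piece v γ :=
  QuotientAddGroup.mk (⟨f, mem_geSubgroup.2 hf⟩ : geSubgroup v γ)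

variable {v : AddValuation R (WithTop Γ)}

theorem Piece.exists_rep {γ : Γ} (z : Piece v γ) : ∃ f hf, Piece.mk v f hf = z := by
  obtain ⟨⟨f, hf⟩, rfl⟩ := QuotientAddGroup.mk_surjective z
  exact ⟨f, hf, rfl⟩

theorem Piece.mk_eq_mk {γ : Γ} {f g : R} (hf : (γ : WithTop Γ) ≤ v f)
    (hg : (γ : WithTop Γ) ≤ v g) :
    Piece.mk v f hf = Piece.mk v g hg ↔ (γ : WithTop Γ) < v (g - f) := by
  unfold Piece.mk
  rw [QuotientAddGroup.eq, AddSubgroup.mem_addSubgroupOf, sub_eq_neg_add]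
  rfl

theorem Piece.sigma_eq {γ γ' : Γ} (h : γ = γ') {f g : R} (hfg : f = g)
    (hf : (γ : WithTop Γ) ≤ v f) (hg : (γ' : WithTop Γ) ≤ v g) :
    GradedMonoid.mk (A := Piece v) γ (Piece.mk v f hf) = GradedMonoid.mk γ' (Piece.mk v g hg) := by
  subst h; subst hfg; rfl

theorem le_map_mul {γ γ' : Γ} {f g : R} (hf : (γ : WithTop Γ) ≤ v f)
    (hg : (γ' : WithTop Γ) ≤ v g) : ((γ + γ' : Γ) : WithTop Γ) ≤ v (f * g) := by
  rw [v.map_mul, WithTop.coe_add]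
  exact add_le_add hf hg

theorem le_map_add {γ : Γ} {f g : R} (hf : (γ : WithTop Γ) ≤ v f)
    (hg : (γ : WithTop Γ) ≤ v g) : (γ : WithTop Γ) ≤ v (f + g) :=
  le_trans (le_min hf hg) (v.map_add f g)

theorem zero_le_map_one : ((0 : Γ) : WithTop Γ) ≤ v 1 := by simp

theorem lt_map_mul {γ γ' : Γ} {f g : R} (hf : (γ : WithTop Γ) < v f)
    (hg : (γ' : WithTop Γ) ≤ v g) : ((γ + γ' : Γ) : WithTop Γ) < v (f * g) := by
  rw [v.map_mul, WithTop.coe_add]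
  exact lt_of_lt_of_le (WithTop.add_lt_add_right WithTop.coe_ne_top hf) (by gcongr)

/-- `(f + 𝒫_β⁺) (g + 𝒫_γ⁺) = fg + 𝒫_{β+γ}⁺`. -/
def Piece.mul {β γ : Γ} : Piece v β → Piece v γ → Piece v (β + γ) :=
  Quotient.map₂ (fun a b => ⟨a.1 * b.1, le_map_mul a.2 b.2⟩) (by
    rintro ⟨a, ha⟩ ⟨a', ha'⟩ h ⟨b, hb⟩ ⟨b', hb'⟩ h'
    have h1 := (Piece.mk_eq_mk ha ha').1 (Quotient.sound h)
    have h2 := (Piece.mk_eq_mk hb hb').1 (Quotient.sound h')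
    refine Quotient.exact ((Piece.mk_eq_mk (le_map_mul ha hb) (le_map_mul ha' hb')).2 ?_)
    have e : a' * b' - a * b = (a' - a) * b + (b' - b) * a' := by ring
    rw [e]
    refine lt_of_lt_of_le (lt_min (lt_map_mul h1 hb) ?_) (v.map_add _ _)
    rw [add_comm β γ]
    exact lt_map_mul h2 ha')

theorem Piece.mk_mul_mk {β γ : Γ} {f g : R} (hf : (β : WithTop Γ) ≤ v f)
    (hg : (γ : WithTop Γ) ≤ v g) :
    Piece.mul (Piece.mk v f hf) (Piece.mk v g hg) = Piece.mk v (f * g) (le_map_mul hf hg) := rfl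

theorem Piece.mk_add_mk {γ : Γ} {f g : R} (hf : (γ : WithTop Γ) ≤ v f)
    (hg : (γ : WithTop Γ) ≤ v g) :
    Piece.mk v f hf + Piece.mk v g hg =
      Piece.mk v (f + g) (le_map_add hf hg) := rfl

theorem Piece.mk_zero {γ : Γ} : (0 : Piece v γ) = Piece.mk v 0 (by simp) := rfl

theorem Piece.mk_congr {γ : Γ} {f g : R} (h : f = g) (hf : (γ : WithTop Γ) ≤ v f)
    (hg : (γ : WithTop Γ) ≤ v g) : Piece.mk v f hf = Piece.mk v g hg := by
  subst h; rfl

instance : GradedMonoid.GOne (Piece v) where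
  one := Piece.mk v 1 zero_le_map_one

instance : GradedMonoid.GMul (Piece v) where
  mul := Piece.mul

instance : GradedMonoid.GCommMonoid (Piece v) where
  one_mul := by
    rintro ⟨i, a⟩
    obtain ⟨f, hf, rfl⟩ := a.exists_rep
    exact Piece.sigma_eq (zero_add i) (one_mul f) (le_map_mul zero_le_map_one hf) hf
  mul_one := by
    rintro ⟨i, a⟩
    obtain ⟨f, hf, rfl⟩ := a.exists_rep
    exact Piece.sigma_eq (add_zero i) (mul_one f) (le_map_mul hf zero_le_map_one) hf
  mul_assoc := by
    rintro ⟨i, a⟩ ⟨j, b⟩ ⟨k, c⟩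
    obtain ⟨f, hf, rfl⟩ := a.exists_rep
    obtain ⟨g, hg, rfl⟩ := b.exists_rep
    obtain ⟨h, hh, rfl⟩ := c.exists_rep
    exact Piece.sigma_eq (add_assoc i j k) (mul_assoc f g h)
      (le_map_mul (le_map_mul hf hg) hh) (le_map_mul hf (le_map_mul hg hh))
  mul_comm := by
    rintro ⟨i, a⟩ ⟨j, b⟩
    obtain ⟨f, hf, rfl⟩ := a.exists_rep
    obtain ⟨g, hg, rfl⟩ := b.exists_rep
    exact Piece.sigma_eq (add_comm i j) (mul_comm f g) (le_map_mul hf hg) (le_map_mul hg hf)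

instance : DirectSum.GCommRing (Piece v) where
  __ := (inferInstance : GradedMonoid.GCommMonoid (Piece v))
  mul_zero a := by
    obtain ⟨f, hf, rfl⟩ := a.exists_rep
    exact Piece.mk_congr (mul_zero f) (le_map_mul hf (by simp)) (by simp)
  zero_mul a := by
    obtain ⟨f, hf, rfl⟩ := a.exists_rep
    exact Piece.mk_congr (zero_mul f) (le_map_mul (by simp) hf) (by simp)
  mul_add a b c := by
    obtain ⟨f, hf, rfl⟩ := a.exists_rep
    obtain ⟨g, hg, rfl⟩ := b.exists_rep
    obtain ⟨h, hh, rfl⟩ := c.exists_rep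
    exact Piece.mk_congr (mul_add f g h) (le_map_mul hf (le_map_add hg hh))
      (le_map_add (le_map_mul hf hg) (le_map_mul hf hh))
  add_mul a b c := by
    obtain ⟨f, hf, rfl⟩ := a.exists_rep
    obtain ⟨g, hg, rfl⟩ := b.exists_rep
    obtain ⟨h, hh, rfl⟩ := c.exists_rep
    exact Piece.mk_congr (add_mul f g h) (le_map_mul (le_map_add hf hg) hh)
      (le_map_add (le_map_mul hf hh) (le_map_mul hg hh))
  natCast n := n • Piece.mk v 1 zero_le_map_one
  natCast_zero := zero_nsmul _
  natCast_succ n := succ_nsmul _ n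
  intCast n := n • Piece.mk v 1 zero_le_map_one
  intCast_ofNat n := natCast_zsmul _ n
  intCast_negSucc_ofNat n := negSucc_zsmul _ n

variable (v) in
/-- The graded ring `𝒢_v = ⨁_γ 𝒫_γ / 𝒫_γ⁺`. The sum is taken over all `γ : Γ`; the components at
those `γ` that are not values of `v` are zero (see `Piece.subsingleton`). -/
abbrev GrRing : Type _ := DirectSum Γ (Piece v)

theorem Piece.subsingleton {γ : Γ} (h : ∀ f, v f ≠ γ) : Subsingleton (Piece v γ) := by
  refine ⟨fun a b => ?_⟩
  obtain ⟨f, hf, rfl⟩ := a.exists_rep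
  obtain ⟨g, hg, rfl⟩ := b.exists_rep
  rw [Piece.mk_eq_mk]
  exact lt_of_le_of_ne ((geSubgroup v γ).sub_mem hg hf) (h _).symm

variable (v) in
/-- The initial form `in_v(f) ∈ 𝒢_v`: the class of `f` in the component of degree `v f`, and `0` if
`v f = ∞`. -/
def inForm (f : R) : GrRing v :=
  open Classical in
  if h : v f = ⊤ then 0
  else DirectSum.of (Piece v) ((v f).untop h) (Piece.mk v f (by simp))

variable {w : AddValuation R (WithTop Γ)}

/-- For `v ≤ w`, the map `𝒫_γ(v) / 𝒫_γ⁺(v) → 𝒫_γ(w) / 𝒫_γ⁺(w)`, `f + 𝒫_γ⁺(v) ↦ f + 𝒫_γ⁺(w)`. -/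
def pieceMap (h : ∀ f, v f ≤ w f) (γ : Γ) : Piece v γ →+ Piece w γ :=
  QuotientAddGroup.map _ _
    (AddSubgroup.inclusion (fun f (hf : (γ : WithTop Γ) ≤ v f) => hf.trans (h f)))
    (fun f hf => lt_of_lt_of_le (AddSubgroup.mem_addSubgroupOf.1 hf) (h f.1))

theorem pieceMap_mk (h : ∀ f, v f ≤ w f) {γ : Γ} {f : R} (hf : (γ : WithTop Γ) ≤ v f) :
    pieceMap h γ (Piece.mk v f hf) = Piece.mk w f (hf.trans (h f)) := rfl

/-- For `v ≤ w`, the graded ring homomorphism `φ : 𝒢_v → 𝒢_w`; on initial forms it is described by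
`grMap_inForm`. -/
def grMap (h : ∀ f, v f ≤ w f) : GrRing v →+* GrRing w :=
  DirectSum.toSemiring (fun γ => (DirectSum.of (Piece w) γ).comp (pieceMap h γ))
    (by rw [DirectSum.one_def]; rfl) (by
    intro i j a b
    obtain ⟨f, hf, rfl⟩ := a.exists_rep
    obtain ⟨g, hg, rfl⟩ := b.exists_rep
    simp only [AddMonoidHom.comp_apply, DirectSum.of_mul_of]
    rfl)

open Classical in
/-- `φ(in_v(f))` is `in_w(f)` if `v f = w f`, and `0` if `v f < w f`. -/
theorem grMap_inForm (h : ∀ f, v f ≤ w f) (f : R) :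
    grMap h (inForm v f) = if v f = w f then inForm w f else 0 := by
  by_cases hv : v f = ⊤
  · have hw : w f = ⊤ := top_le_iff.1 (hv ▸ h f)
    simp [inForm, hv, hw]
  · have e : grMap h (inForm v f) =
        DirectSum.of (Piece w) ((v f).untop hv) (Piece.mk w f (by simpa using h f)) := by
      rw [inForm, dif_neg hv, grMap, DirectSum.toSemiring_of]
      rfl
    rw [e]
    split_ifs with hvw
    · have hw : w f ≠ ⊤ := hvw ▸ hv
      rw [inForm, dif_neg hw]
      exact DirectSum.of_eq_of_gradedMonoid_eq
        (Piece.sigma_eq (by simp only [hvw]) rfl _ _)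
    · have : Piece.mk w f (γ := (v f).untop hv) (by simpa using h f) = 0 := by
        rw [Piece.mk_zero, eq_comm, Piece.mk_eq_mk]
        simpa using lt_of_le_of_ne (h f) hvw
      rw [this, _root_.map_zero]

end Graded

/-! ### Truncations -/

section Truncation

variable {K Γ : Type*} [Field K] [AddCommGroup Γ] [LinearOrder Γ] [IsOrderedAddMonoid Γ]

/-- The `i`-th coefficient `f_i` of the `q`-expansion `f = f_0 + f_1 q + ⋯ + f_s q ^ s`,
`deg f_i < deg q`, of `f`, for a non-constant polynomial `q`
(see `degree_qCoeff_lt` and `sum_qCoeff`). -/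
def qCoeff (q : K[X]) : K[X] → ℕ → K[X]
  | f, 0 => f % q
  | f, i + 1 => qCoeff q (f / q) i

theorem degree_qCoeff_lt {q : K[X]} (hq : 0 < q.degree) (f : K[X]) (i : ℕ) :
    (qCoeff q f i).degree < q.degree := by
  induction i generalizing f with
  | zero => exact EuclideanDomain.mod_lt _ (ne_zero_of_degree_gt hq)
  | succ i ih => exact ih _

theorem sum_qCoeff {q : K[X]} (hq : 0 < q.degree) (N : ℕ) (f : K[X]) (hN : f.degree < N) :
    ∑ i ∈ Finset.range N, qCoeff q f i * q ^ i = f := by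
  induction N generalizing f with
  | zero => simpa using (degree_eq_bot.1 (Nat.WithBot.lt_zero_iff.1 hN)).symm
  | succ N ih =>
    have hd : (f / q).degree < N := by
      rcases eq_or_ne f 0 with rfl | hf
      · simp
      · have h1 := degree_div_lt hf hq
        rw [degree_eq_natDegree hf] at h1 hN
        exact lt_of_lt_of_le h1 (by exact_mod_cast Nat.lt_succ_iff.1 (by exact_mod_cast hN))
    have h2 := ih (f / q) hd
    rw [Finset.sum_range_succ']
    simp only [qCoeff, pow_succ, pow_zero, mul_one, ← mul_assoc]
    rw [← Finset.sum_mul, h2, mul_comm]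
    exact EuclideanDomain.div_add_mod f q

/-- The truncation `ν_q(f) = min_i ν(f_i q ^ i)` of `ν` at a non-constant polynomial `q`. The
`q`-expansion of `f` has no non-zero coefficients beyond the index `deg f`, and zero coefficients do
not contribute to the minimum. -/
def truncation (ν : AddValuation K[X] (WithTop Γ)) (q f : K[X]) : WithTop Γ :=
  (Finset.range (f.natDegree + 1)).inf fun i => ν (qCoeff q f i * q ^ i)

/-- The truncation of `ν` at `q` as a valuation. This type has one element if the
map `truncation ν q` is a valuation and is empty if not. -/
structure TruncVal (ν : AddValuation K[X] (WithTop Γ)) (q : K[X]) where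
  /-- the valuation `ν_q` -/
  val : AddValuation K[X] (WithTop Γ)
  val_eq : ∀ f, val f = truncation ν q f

/-- The graded ring `𝒢_q` of the valuation `ν_q`. -/
abbrev TruncVal.Gr {ν : AddValuation K[X] (WithTop Γ)} {q : K[X]} (w : TruncVal ν q) : Type _ :=
  GrRing w.val

/-- `R_q`: the additive subgroup of `𝒢_q` generated by the initial forms `in_q(f)`,
`deg f < deg q`. -/
def TruncVal.R {ν : AddValuation K[X] (WithTop Γ)} {q : K[X]} (w : TruncVal ν q) :
    AddSubgroup w.Gr :=
  AddSubgroup.closure {z | ∃ f : K[X], f.degree < q.degree ∧ inForm w.val f = z}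

/-- The map `φ_{QQ'} : 𝒢_Q → 𝒢_Q'` for `ν_Q ≤ ν_Q'`. -/
def TruncVal.phi {ν : AddValuation K[X] (WithTop Γ)} {Q Q' : K[X]} (w : TruncVal ν Q)
    (w' : TruncVal ν Q') (h : ∀ f, truncation ν Q f ≤ truncation ν Q' f) : w.Gr →+* w'.Gr :=
  grMap fun f => by rw [w.val_eq, w'.val_eq]; exact h f

end Truncation

/-! ### Key polynomials and limit key polynomials -/

section Key

variable {K L Γ Γ' : Type*} [Field K] [Field L] [Algebra K L]
  [AddCommGroup Γ] [LinearOrder Γ] [IsOrderedAddMonoid Γ]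
  [AddCommGroup Γ'] [LinearOrder Γ'] [IsOrderedAddMonoid Γ']

/-- `δ(f) = max {ν̄(x - a) | f(a) = 0}` for a non-constant polynomial `f` over an algebraically
closed field, and `δ(f) = -∞` for a non-zero constant `f`. -/
def delta (νbar : AddValuation L[X] (WithTop Γ')) (f : L[X]) : WithBot (WithTop Γ') :=
  open Classical in f.roots.toFinset.sup fun a => ((νbar (X - C a) : WithTop Γ') : WithBot _)

/-- `Q` is a key polynomial (for the restriction to `K[x]` of the valuation `ν̄` of `L[x]`, `L` an
algebraic closure of `K`). -/
def IsKeyPoly (νbar : AddValuation L[X] (WithTop Γ')) (Q : K[X]) : Prop :=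
  Q.Monic ∧ ∀ f : K[X], f ≠ 0 →
    delta νbar (Q.map (algebraMap K L)) ≤ delta νbar (f.map (algebraMap K L)) →
      Q.degree ≤ f.degree

/-- `Ψ_n`: the key polynomials of degree `n`. The valuation `ν` enters through the preorder. -/
structure Psi (ν : AddValuation K[X] (WithTop Γ)) (νbar : AddValuation L[X] (WithTop Γ'))
    (n : ℕ) where
  /-- the key polynomial -/
  poly : K[X]
  isKeyPoly : IsKeyPoly νbar poly
  natDegree_eq : poly.natDegree = n

/-- `Q ⪯ Q'` if and only if `ν_Q ≤ ν_Q'`. -/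
instance (ν : AddValuation K[X] (WithTop Γ)) (νbar : AddValuation L[X] (WithTop Γ')) (n : ℕ) :
    Preorder (Psi ν νbar n) where
  le Q Q' := ∀ f, truncation ν Q.poly f ≤ truncation ν Q'.poly f
  le_refl _ _ := le_rfl
  le_trans _ _ _ h h' f := (h f).trans (h' f)

/-- `𝒦_n = {f | ν_Q(f) < ν(f) for all Q ∈ Ψ_n}`. -/
def limitSet (ν : AddValuation K[X] (WithTop Γ)) (νbar : AddValuation L[X] (WithTop Γ')) (n : ℕ) :
    Set K[X] :=
  {f | ∀ Q : Psi ν νbar n, truncation ν Q.poly f < ν f}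

/-- `Qn` is a limit key polynomial for `Ψ_n`: a monic polynomial of least degree in `𝒦_n`. -/
def IsLimitKeyPoly (ν : AddValuation K[X] (WithTop Γ)) (νbar : AddValuation L[X] (WithTop Γ'))
    (n : ℕ) (Qn : K[X]) : Prop :=
  Qn.Monic ∧ Qn ∈ limitSet ν νbar n ∧ ∀ f ∈ limitSet ν νbar n, Qn.degree ≤ f.degree

end Key

end KeyPoly

end

open KeyPoly

/-! Everything is compared with `ν_{Qn}`. Since `ν_Q ≤ ν_{Qn}` for all `Q ∈ Ψ_n`
(`IsLimitKeyPoly.val_le`), the maps `𝒢_Q → 𝒢_{Qn}` glue to a ring homomorphism `F` on the direct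
limit. It is injective because a value `ν_Q f` that is still below `ν_{Qn} f` increases at some
later stage (`IsLimitKeyPoly.exists_val_lt`), so a class that dies in `𝒢_{Qn}` already dies in some
`𝒢_{Q'}`. Its image is `R_{Qn}`: by minimality of `deg Qn`, polynomials of smaller degree eventually
satisfy `ν_Q f = ν f`, so their initial forms are reached; conversely, if `ν_Q f = ν_{Qn} f`, then
`f` and its remainder modulo `Qn` have the same initial form (`IsLimitKeyPoly.inForm_mem_R`). Both
arguments rest on `ν_Q(Qn) < ν(Qn)`.

Truncations are valuations by one criterion, `PreservedByMod`: reducing a product of two polynomials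
of degree `< deg q` modulo `q` must not change its value. A key polynomial satisfies it by
evaluation at a root where `δ` is attained; `Qn` satisfies it because its values `ν_Q(Qn)` never
reach `ν(Qn)`. -/

noncomputable section

namespace KeyPoly

/-! ### Truncations: when they are valuations, and how they compare. -/

section TruncationTheory

variable {K Γ : Type*} [Field K] [AddCommGroup Γ] [LinearOrder Γ] [IsOrderedAddMonoid Γ]
  {ν : AddValuation K[X] (WithTop Γ)} {q : K[X]}

theorem degree_div_lt_natCast (hq : 0 < q.degree) {f : K[X]} {i : ℕ} (h : f.degree < (i + 1 : ℕ)) :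
    (f / q).degree < i := by
  rcases eq_or_ne f 0 with rfl | hf
  · simp
  · have h1 := degree_div_lt hf hq
    rw [degree_eq_natDegree hf] at h1 h
    exact lt_of_lt_of_le h1 (by exact_mod_cast Nat.lt_succ_iff.1 (by exact_mod_cast h))

theorem qCoeff_eq_zero (hq : 0 < q.degree) {f : K[X]} {i : ℕ} (h : f.degree < i) :
    qCoeff q f i = 0 := by
  induction i generalizing f with
  | zero =>
    have : f = 0 := degree_eq_bot.1 (Nat.WithBot.lt_zero_iff.1 h)
    simp [qCoeff, this]
  | succ i ih => exact ih (degree_div_lt_natCast hq h)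

theorem add_div_eq (hq : q ≠ 0) (f g : K[X]) : (f + g) / q = f / q + g / q := by
  apply mul_left_cancel₀ hq
  have h1 := EuclideanDomain.div_add_mod (f + g) q
  have h2 := EuclideanDomain.div_add_mod f q
  have h3 := EuclideanDomain.div_add_mod g q
  rw [add_mod] at h1
  linear_combination h1 - h2 - h3

theorem qCoeff_add (hq : q ≠ 0) (f g : K[X]) (i : ℕ) :
    qCoeff q (f + g) i = qCoeff q f i + qCoeff q g i := by
  induction i generalizing f g with
  | zero => exact add_mod f g q
  | succ i ih => simp only [qCoeff, add_div_eq hq, ih]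

/-- The truncation may be computed with any sufficiently long `q`-expansion. -/
theorem truncation_eq_inf (hq : 0 < q.degree) {f : K[X]} {N : ℕ} (hN : f.natDegree < N) :
    truncation ν q f = (Finset.range N).inf fun i => ν (qCoeff q f i * q ^ i) := by
  apply le_antisymm
  · refine Finset.le_inf fun i _ => ?_
    by_cases hi : i < f.natDegree + 1
    · exact Finset.inf_le (Finset.mem_range.2 hi)
    · rw [qCoeff_eq_zero hq, zero_mul, ν.map_zero]
      · exact le_top
      · exact lt_of_le_of_lt degree_le_natDegree (by exact_mod_cast not_lt.1 hi)
  · exact Finset.inf_mono (Finset.range_mono hN)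

theorem truncation_zero : truncation ν q 0 = ⊤ := by
  simp [truncation, qCoeff]

/-- The `q`-expansion of `f` is `f % q` followed by that of `f / q` shifted by one power of `q`.
This recursion replaces explicit expansions in most later arguments. -/
theorem truncation_eq_min (hq : 0 < q.degree) (f : K[X]) :
    truncation ν q f = min (ν (f % q)) (truncation ν q (f / q) + ν q) := by
  have hd : (f / q).natDegree < f.natDegree + 1 :=
    Nat.lt_succ_of_le (natDegree_le_natDegree (degree_div_le f q))
  rw [truncation_eq_inf hq (N := f.natDegree + 1 + 1) (by omega), truncation_eq_inf hq hd,
    Finset.range_add_one', Finset.inf_insert, Finset.inf_map]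
  congr 1
  · simp [qCoeff]
  · rw [Finset.apply_inf_eq_inf_comp_of_linearOrder (fun x : WithTop Γ => x + ν q)
      (fun a b h => by simpa using add_le_add_left h (ν q)) (top_add _)]
    refine Finset.inf_congr rfl fun i _ => ?_
    change ν (qCoeff q (f / q) i * q ^ (i + 1)) = ν (qCoeff q (f / q) i * q ^ i) + ν q
    rw [pow_succ, ← mul_assoc, ν.map_mul (_ * _) q]

theorem truncation_le_map_mod (hq : 0 < q.degree) (f : K[X]) :
    truncation ν q f ≤ ν (f % q) := by
  rw [truncation_eq_min hq]; exact min_le_left _ _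

theorem truncation_of_degree_lt (hq : 0 < q.degree) {f : K[X]} (hf : f.degree < q.degree) :
    truncation ν q f = ν f := by
  have h0 := ne_zero_of_degree_gt hq
  rw [truncation_eq_min hq, (mod_eq_self_iff h0).2 hf, (Polynomial.div_eq_zero_iff h0).2 hf,
    truncation_zero, top_add, min_eq_left le_top]

theorem truncation_mul_self (hq : 0 < q.degree) (f : K[X]) :
    truncation ν q (q * f) = truncation ν q f + ν q := by
  have h0 := ne_zero_of_degree_gt hq
  rw [truncation_eq_min hq, mul_div_cancel_left₀ _ h0,
    (EuclideanDomain.mod_eq_zero).2 (dvd_mul_right q f), ν.map_zero, min_eq_right le_top]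

theorem truncation_self (hq : 0 < q.degree) : truncation ν q q = ν q := by
  have := truncation_mul_self (ν := ν) hq 1
  rwa [mul_one, truncation_of_degree_lt hq (f := 1) (by simpa using hq), ν.map_one, zero_add] at this

/-- A valuation that dominates `ν` in degrees below `deg q` and at `q` dominates `ν_q`. -/
theorem truncation_le_of_le (hq : 0 < q.degree) {w : AddValuation K[X] (WithTop Γ)}
    (h : ∀ f : K[X], f.degree < q.degree → ν f ≤ w f) (h' : ν q ≤ w q) (f : K[X]) :
    truncation ν q f ≤ w f := by
  have hs := sum_qCoeff hq (f.natDegree + 1) f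
    (lt_of_le_of_lt degree_le_natDegree (by exact_mod_cast Nat.lt_succ_self _))
  conv_rhs => rw [← hs]
  refine w.map_le_sum fun i hi => (Finset.inf_le hi).trans ?_
  rw [ν.map_mul, w.map_mul, ν.map_pow, w.map_pow]
  exact add_le_add (h _ (degree_qCoeff_lt hq f i)) (nsmul_le_nsmul_right h' i)

theorem truncation_le (hq : 0 < q.degree) (f : K[X]) : truncation ν q f ≤ ν f :=
  truncation_le_of_le hq (fun _ _ => le_rfl) le_rfl f

theorem min_le_truncation_add (hq : 0 < q.degree) (f g : K[X]) :
    min (truncation ν q f) (truncation ν q g) ≤ truncation ν q (f + g) := by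
  set N := max f.natDegree (max g.natDegree (f + g).natDegree) + 1 with hN
  rw [truncation_eq_inf (N := N) hq (by omega), truncation_eq_inf (f := g) (N := N) hq (by omega),
    truncation_eq_inf (f := f + g) (N := N) hq (by omega)]
  refine Finset.le_inf fun i hi => ?_
  rw [qCoeff_add (ne_zero_of_degree_gt hq), add_mul]
  exact (min_le_min (Finset.inf_le hi) (Finset.inf_le hi)).trans (ν.map_add _ _)

theorem truncation_neg (hq : 0 < q.degree) (f : K[X]) :
    truncation ν q (-f) = truncation ν q f := by
  have h0 : ∀ i, qCoeff q (-f) i = -qCoeff q f i := fun i => by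
    have h1 := qCoeff_add (ne_zero_of_degree_gt hq) (-f) f i
    rw [neg_add_cancel] at h1
    have h2 : qCoeff q 0 i = 0 := qCoeff_eq_zero hq (by simp)
    rw [h2] at h1
    exact eq_neg_of_add_eq_zero_left h1.symm
  simp only [truncation, natDegree_neg, h0, neg_mul, ν.map_neg]

theorem min_le_truncation_sub (hq : 0 < q.degree) (f g : K[X]) :
    min (truncation ν q f) (truncation ν q g) ≤ truncation ν q (f - g) := by
  simpa [sub_eq_add_neg, truncation_neg hq] using min_le_truncation_add (ν := ν) hq f (-g)

variable (ν q) in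
/-- `ν` does not increase or drop when a product of two polynomials of degree less than `deg q` is
reduced modulo the non-constant polynomial `q`. -/
structure PreservedByMod : Prop where
  degree_pos : 0 < q.degree
  map_mul_mod : ∀ f g : K[X], f.degree < q.degree → g.degree < q.degree →
    ν (f * g % q) = ν (f * g)

/-- Induction on the length of the `q`-expansion, in the form of the degree drop from `f` to `f /
q`. -/
theorem div_induction (hq : 0 < q.degree) {P : K[X] → Prop}
    (h0 : ∀ f, f.degree < q.degree → P f) (h1 : ∀ f, P (f / q) → P f) (f : K[X]) : P f := by
  induction hn : f.natDegree using Nat.strong_induction_on generalizing f with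
  | _ n ih =>
    by_cases hf : f.degree < q.degree
    · exact h0 f hf
    · refine h1 f (ih _ ?_ _ rfl)
      rw [← hn]
      have hf0 : 0 < f.degree := hq.trans_le (not_lt.1 hf)
      by_cases h : f / q = 0
      · rw [h, natDegree_zero]
        exact natDegree_pos_iff_degree_pos.2 hf0
      · exact natDegree_lt_natDegree h (degree_div_lt (ne_zero_of_degree_gt hf0) hq)

/-- Splitting `f = f % q + q (f / q)` reduces to factors of degree `< deg q`, because multiplication
by `q` adds exactly `ν q`. For such factors `f g = c q + r`, the hypothesis gives `ν r = ν (f g)`,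
and hence `ν (c q) = ν (f g - r) ≥ ν (f g)`. -/
theorem PreservedByMod.add_le_truncation_mul (H : PreservedByMod ν q) (f g : K[X]) :
    truncation ν q f + truncation ν q g ≤ truncation ν q (f * g) := by
  have hq := H.degree_pos
  have step : ∀ f g, truncation ν q (f % q) + truncation ν q g ≤ truncation ν q (f % q * g) →
      truncation ν q (f / q) + truncation ν q g ≤ truncation ν q (f / q * g) →
      truncation ν q f + truncation ν q g ≤ truncation ν q (f * g) := by
    intro f g h0 h1
    have e : f * g = f % q * g + q * (f / q * g) := by
      conv_lhs => rw [← EuclideanDomain.div_add_mod f q]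
      ring
    rw [e]
    refine le_trans (le_min ?_ ?_) (min_le_truncation_add hq _ _)
    · refine le_trans ?_ h0
      gcongr
      rw [truncation_of_degree_lt hq (EuclideanDomain.mod_lt _ (ne_zero_of_degree_gt hq))]
      exact truncation_le_map_mod hq f
    · rw [truncation_mul_self hq]
      calc truncation ν q f + truncation ν q g
          ≤ truncation ν q (f / q) + ν q + truncation ν q g := by
            gcongr; rw [truncation_eq_min hq]; exact min_le_right _ _
        _ = truncation ν q (f / q) + truncation ν q g + ν q := by abel
        _ ≤ _ := by gcongr
  have base : ∀ f g : K[X], f.degree < q.degree → g.degree < q.degree →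
      truncation ν q f + truncation ν q g ≤ truncation ν q (f * g) := by
    intro f g hf hg
    have h0 := ne_zero_of_degree_gt hq
    -- As `deg (f g) < 2 deg q`, the expansion of `f g` has at most two terms.
    have hc : (f * g / q).degree < q.degree := by
      by_cases hz : f * g / q = 0
      · rw [hz, degree_zero]; exact bot_lt_iff_ne_bot.2 (by simpa using h0)
      have h2 := degree_add_div h0 (not_lt.1 (mt (Polynomial.div_eq_zero_iff h0).2 hz))
      rw [degree_mul] at h2
      have hf0 : f ≠ 0 := by rintro rfl; simp at hz
      have hg0 : g ≠ 0 := by rintro rfl; simp at hz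
      rw [degree_eq_natDegree h0, degree_eq_natDegree hz, degree_eq_natDegree hf0,
        degree_eq_natDegree hg0] at *
      norm_cast at *
      omega
    rw [truncation_of_degree_lt hq hf, truncation_of_degree_lt hq hg, truncation_eq_min hq,
      H.map_mul_mod f g hf hg, truncation_of_degree_lt hq hc, ← ν.map_mul, ← ν.map_mul]
    refine le_min le_rfl ?_
    have e : f * g / q * q = f * g - f * g % q := by
      linear_combination EuclideanDomain.div_add_mod (f * g) q
    rw [e]
    exact ν.map_le_sub le_rfl (H.map_mul_mod f g hf hg).ge
  have mid : ∀ f g : K[X], f.degree < q.degree →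
      truncation ν q f + truncation ν q g ≤ truncation ν q (f * g) := by
    intro f g hf
    induction g using div_induction hq with
    | h0 g hg => exact base f g hf hg
    | h1 g ih =>
      have h := step g f
      rw [mul_comm g f, mul_comm (g % q), mul_comm (g / q), add_comm (truncation ν q (g % q)),
        add_comm (truncation ν q (g / q)), add_comm (truncation ν q g)] at h
      exact h (base f _ hf (EuclideanDomain.mod_lt _ (ne_zero_of_degree_gt hq))) ih
  induction f using div_induction hq with
  | h0 f hf => exact mid f g hf
  | h1 f ih => exact step f g (mid _ _ (EuclideanDomain.mod_lt _ (ne_zero_of_degree_gt hq))) ih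

/-- If both minima are attained at index `0`, the remainder of `f g` already has value `ν_q f + ν_q
g`. If the minimum for `f` is not attained there, `f % q` is negligible, and the claim for `f / q`
passes to `f`: a larger value of `f g` would make both terms of `q (f / q) g = f g - (f % q) g` too
large. -/
theorem PreservedByMod.truncation_mul (H : PreservedByMod ν q) (f g : K[X]) :
    truncation ν q (f * g) = truncation ν q f + truncation ν q g := by
  have hq := H.degree_pos
  have hm : ∀ f : K[X], (f % q).degree < q.degree := fun f =>
    EuclideanDomain.mod_lt _ (ne_zero_of_degree_gt hq)
  have step : ∀ f g, truncation ν q f ≠ ν (f % q) →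
      truncation ν q (f / q * g) = truncation ν q (f / q) + truncation ν q g →
      truncation ν q (f * g) = truncation ν q f + truncation ν q g := by
    intro f g hf ih
    have hlt := lt_of_le_of_ne (truncation_le_map_mod hq f) hf
    have hf' : truncation ν q f = truncation ν q (f / q) + ν q := by
      rw [truncation_eq_min hq f]
      rcases min_choice (ν (f % q)) (truncation ν q (f / q) + ν q) with h | h
      · exact absurd ((truncation_eq_min hq f).trans h) hf
      · exact h
    refine le_antisymm ?_ (H.add_le_truncation_mul f g)
    by_contra! hc
    have hg : truncation ν q g ≠ ⊤ := by
      intro h; rw [h, add_top] at hc; exact not_top_lt hc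
    have e : q * (f / q * g) = f * g - f % q * g := by
      linear_combination g * EuclideanDomain.div_add_mod f q
    have h1 := min_le_truncation_sub (ν := ν) hq (f * g) (f % q * g)
    rw [← e, truncation_mul_self hq, ih] at h1
    refine absurd h1 (not_le.2 (lt_min ?_ ?_))
    · rwa [add_right_comm, ← hf']
    · rw [add_right_comm, ← hf']
      refine lt_of_lt_of_le ?_ (H.add_le_truncation_mul (f % q) g)
      rw [truncation_of_degree_lt hq (hm f)]
      exact WithTop.add_lt_add_right hg hlt
  have base : ∀ f g, truncation ν q f = ν (f % q) → truncation ν q g = ν (g % q) →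
      truncation ν q (f * g) = truncation ν q f + truncation ν q g := by
    intro f g hf hg
    refine le_antisymm ?_ (H.add_le_truncation_mul f g)
    refine (truncation_le_map_mod hq _).trans ?_
    rw [mul_mod, H.map_mul_mod _ _ (hm f) (hm g), ν.map_mul, hf, hg]
  have low : ∀ f : K[X], f.degree < q.degree → truncation ν q f = ν (f % q) := fun f hf => by
    rw [(mod_eq_self_iff (ne_zero_of_degree_gt hq)).2 hf, truncation_of_degree_lt hq hf]
  have mid : ∀ f g, truncation ν q f = ν (f % q) →
      truncation ν q (f * g) = truncation ν q f + truncation ν q g := by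
    intro f g hf
    induction g using div_induction hq with
    | h0 g hg => exact base f g hf (low g hg)
    | h1 g ih =>
      by_cases hg : truncation ν q g = ν (g % q)
      · exact base f g hf hg
      · rw [mul_comm, add_comm]
        exact step g f hg (by rw [mul_comm, ih, add_comm])
  induction f using div_induction hq with
  | h0 f hf => exact mid f g (low f hf)
  | h1 f ih =>
    by_cases hf : truncation ν q f = ν (f % q)
    · exact mid f g hf
    · exact step f g hf ih

/-- The truncation `ν_q` is a valuation. -/
def PreservedByMod.truncVal (H : PreservedByMod ν q) : TruncVal ν q where
  val := AddValuation.of (truncation ν q) truncation_zero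
    (by rw [truncation_of_degree_lt H.degree_pos (by simpa using H.degree_pos), ν.map_one])
    (min_le_truncation_add H.degree_pos) H.truncation_mul
  val_eq _ := rfl

/-- Suppose `w ≤ w'` agree at `f` and `r`, but not at `p`. If `f = p g + r` and
`w' f ≤ w' (p g)`, then the last inequality is strict. -/
theorem lt_map_mul_of_map_eq {w w' : AddValuation K[X] (WithTop Γ)} (h : ∀ f, w f ≤ w' f)
    {p f g r : K[X]} (hp : w p < w' p) (hf : f = p * g + r) (hr : w r = w' r) (hwf : w f = w' f)
    (htop : w' f ≠ ⊤) (hle : w' f ≤ w' (p * g)) : w' f < w' (p * g) := by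
  refine lt_of_le_of_ne hle fun heq => ?_
  have hg : w' g ≠ ⊤ := by
    intro hg; rw [w'.map_mul, hg, add_top] at heq; exact htop heq
  -- If equality held, `p` would force `w (p g)` below `w' f`, while `p g = f - r`, with `f` and `r`
  -- unchanged, forces `w (p g) ≥ w' f`.
  have h1 : w (p * g) < w' f := by
    rw [heq, w.map_mul, w'.map_mul]
    exact lt_of_le_of_lt (add_le_add le_rfl (h g)) (WithTop.add_lt_add_right hg hp)
  have h2 : w' f ≤ w r := by
    rw [hr, show r = f - p * g by rw [hf]; ring]
    exact w'.map_le_sub le_rfl hle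
  have h3 : w' f ≤ w (p * g) := by
    rw [show p * g = f - r by rw [hf]; ring]
    exact w.map_le_sub hwf.ge h2
  exact absurd h1 (not_lt.2 h3)

theorem TruncVal.map_of_degree_lt (w : TruncVal ν q) (hq : 0 < q.degree) {f : K[X]}
    (hf : f.degree < q.degree) : w.val f = ν f := by
  rw [w.val_eq, truncation_of_degree_lt hq hf]

theorem TruncVal.map_self (w : TruncVal ν q) (hq : 0 < q.degree) : w.val q = ν q := by
  rw [w.val_eq, truncation_self hq]

theorem TruncVal.le (w : TruncVal ν q) (hq : 0 < q.degree) (f : K[X]) : w.val f ≤ ν f := by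
  rw [w.val_eq]; exact truncation_le hq f

theorem TruncVal.le_map_mod (w : TruncVal ν q) (hq : 0 < q.degree) (f : K[X]) :
    w.val f ≤ w.val (f % q) := by
  rw [w.map_of_degree_lt hq (EuclideanDomain.mod_lt _ (ne_zero_of_degree_gt hq)), w.val_eq]
  exact truncation_le_map_mod hq f

theorem TruncVal.le_map_mul_div (w : TruncVal ν q) (hq : 0 < q.degree) (f : K[X]) :
    w.val f ≤ w.val (q * (f / q)) := by
  rw [w.val_eq, w.val_eq, truncation_mul_self hq, truncation_eq_min hq]
  exact min_le_right _ _

/-- If a valuation `w ≤ ν_q` is smaller than `ν_q` at `q` and agrees with it at `f` and `f % q`,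
then `f` and `f % q` have the same initial form for `ν_q`. -/
theorem TruncVal.lt_map_mul_div (w' : TruncVal ν q) (hq : 0 < q.degree)
    {w : AddValuation K[X] (WithTop Γ)} (h : ∀ f, w f ≤ w'.val f) (hwq : w q < w'.val q)
    {f : K[X]} (hr : w (f % q) = w'.val (f % q)) (hf : w f = w'.val f) (htop : w'.val f ≠ ⊤) :
    w'.val f < w'.val (q * (f / q)) :=
  lt_map_mul_of_map_eq h hwq (EuclideanDomain.div_add_mod f q).symm hr hf htop
    (w'.le_map_mul_div hq f)

theorem degree_sub_lt_of_monic {p q : K[X]} (hp : p.Monic) (hq : q.Monic)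
    (h : p.degree = q.degree) : (p - q).degree < q.degree := by
  rw [← h]
  exact degree_sub_lt_left h hp.ne_zero (by rw [hp.leadingCoeff, hq.leadingCoeff])

/-- Only the value at `p` needs care: in `p = q + (p - q)` the difference has degree `< deg q`, so
`ν_q` and `ν` agree on both terms, which have value at least `ν p`. -/
theorem TruncVal.truncation_le_of_map_le {p : K[X]} (w : TruncVal ν q) (hq : 0 < q.degree)
    (hp : p.Monic) (hqm : q.Monic) (hd : p.degree = q.degree) (hle : ν p ≤ ν q) (f : K[X]) :
    truncation ν p f ≤ w.val f := by
  refine truncation_le_of_le (hd ▸ hq) (fun f hf => ?_) ?_ f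
  · rw [w.map_of_degree_lt hq (hd ▸ hf)]
  · rw [← add_sub_cancel q p]
    conv_lhs => rw [add_sub_cancel q p]
    refine w.val.map_le_add (by rwa [w.map_self hq]) ?_
    rw [w.map_of_degree_lt hq (degree_sub_lt_of_monic hp hqm hd)]
    exact ν.map_le_sub le_rfl hle

/-- For monic polynomials `p`, `q` of the same degree with `ν p < ν q`, the valuations `ν_p` and
`ν_q` agree at `f` only if they agree with `ν` there. -/
theorem TruncVal.eq_of_eq {p : K[X]} (w : TruncVal ν p) (w' : TruncVal ν q) (hq : 0 < q.degree)
    (hp : p.Monic) (hqm : q.Monic) (hd : p.degree = q.degree) (hlt : ν p < ν q) {f : K[X]}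
    (hf : w.val f = w'.val f) : w.val f = ν f := by
  have hp0 : 0 < p.degree := hd ▸ hq
  refine le_antisymm (w.le hp0 f) ?_
  by_cases htop : w'.val f = ⊤
  · rw [hf, htop]; exact le_top
  have hle : ∀ f, w.val f ≤ w'.val f := fun f => by
    rw [w.val_eq]; exact w'.truncation_le_of_map_le hq hp hqm hd hlt.le f
  have hsub : (q - p).degree < p.degree := degree_sub_lt_of_monic hqm hp hd.symm
  have hwq : w.val q < w'.val q := by
    rw [w'.map_self hq]
    refine lt_of_le_of_lt ?_ hlt
    -- The `p`-expansion of `q` is `(q - p) + p`, and `ν (q - p) = ν p < ν q`.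
    have hmod : q % p = q - p := by
      rw [← (mod_eq_self_iff hp.ne_zero).2 hsub, sub_mod, EuclideanDomain.mod_self, sub_zero]
    have h1 := w.le_map_mod hp0 q
    rwa [hmod, w.map_of_degree_lt hp0 hsub, ν.map_sub_eq_of_lt_right hlt] at h1
  have hrd := EuclideanDomain.mod_lt f (ne_zero_of_degree_gt hq)
  have h1 := w'.lt_map_mul_div hq hle hwq
    (by rw [w.map_of_degree_lt hp0 (hd ▸ hrd), w'.map_of_degree_lt hq hrd]) hf htop
  have h2 : w'.val (f % q) = w'.val f := by
    have e : f % q = f - q * (f / q) := by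
      linear_combination EuclideanDomain.div_add_mod f q
    rw [e, w'.val.map_sub_eq_of_lt_left h1]
  rw [w'.map_of_degree_lt hq hrd] at h2
  -- The remainder `f % q` dominates for `ν` as well, since passing from `ν_q` to `ν` can only raise
  -- the multiple of `q`.
  have h3 : ν f = w'.val f := by
    rw [← EuclideanDomain.div_add_mod f q, ν.map_add_eq_of_lt_right, EuclideanDomain.div_add_mod,
      h2]
    rw [h2]
    exact h1.trans_le (w'.le hq _)
  rw [hf, h3]

end TruncationTheory

/-! ### Key polynomials: evaluation at an optimal root. -/

section KeyPolyTheory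

variable {K L Γ Γ' : Type*} [Field K] [Field L] [Algebra K L]
  [AddCommGroup Γ] [LinearOrder Γ] [IsOrderedAddMonoid Γ]
  [AddCommGroup Γ'] [LinearOrder Γ'] [IsOrderedAddMonoid Γ']

/-- Factor by factor: `a - b = (x - b) - (x - a)`, and the first term has the strictly smaller
value. -/
theorem map_eval_eq_of_roots [IsAlgClosed L] (v : AddValuation L[X] (WithTop Γ')) (a : L)
    (f : L[X]) (h : ∀ b ∈ f.roots, v (X - C b) < v (X - C a)) :
    v (C (f.eval a)) = v f := by
  have hs := (IsAlgClosed.splits f).eq_prod_roots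
  conv_rhs => rw [hs]
  conv_lhs => rw [hs]
  generalize f.roots = s at h
  rw [eval_mul, eval_C, C_mul, v.map_mul, v.map_mul]
  congr 1
  induction s using Multiset.induction_on with
  | empty => simp
  | cons b s ih =>
    rw [Multiset.map_cons, Multiset.prod_cons, eval_mul, C_mul, v.map_mul, v.map_mul,
      ih fun c hc => h c (Multiset.mem_cons_of_mem hc)]
    congr 1
    have e : C ((X - C b).eval a) = (X - C b) - (X - C a) := by simp
    rw [e, v.map_sub_eq_of_lt_left (h b (Multiset.mem_cons_self b s))]

/-- A key polynomial has a root `a` such that the values of polynomials of smaller degree do not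
change when they are evaluated at `a`. -/
theorem IsKeyPoly.exists_root [IsAlgClosed L] {νbar : AddValuation L[X] (WithTop Γ')} {Q : K[X]}
    (hQ : IsKeyPoly νbar Q) (hd : 0 < Q.degree) :
    ∃ a : L, Q.aeval a = 0 ∧ ∀ f : K[X], f.degree < Q.degree →
      νbar (C (f.aeval a)) = νbar (f.map (algebraMap K L)) := by
  classical
  have hQ0 : Q.map (algebraMap K L) ≠ 0 := (hQ.1.map _).ne_zero
  have hne : (Q.map (algebraMap K L)).roots.toFinset.Nonempty := by
    obtain ⟨a, ha⟩ := IsAlgClosed.exists_root (Q.map (algebraMap K L))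
      (by rw [degree_map]; exact hd.ne')
    exact ⟨a, by simpa [hQ.1.ne_zero] using ha⟩
  -- The root `a` is one at which the maximum defining `δ(Q)` is attained.
  obtain ⟨a, ha, hsup⟩ := Finset.exists_mem_eq_sup _ hne
    fun a => ((νbar (X - C a) : WithTop Γ') : WithBot (WithTop Γ'))
  refine ⟨a, ?_, fun f hf => ?_⟩
  · have := (mem_roots hQ0).1 (Multiset.mem_toFinset.1 ha)
    rwa [IsRoot, eval_map_algebraMap] at this
  · rw [← eval_map_algebraMap]
    refine map_eval_eq_of_roots νbar a _ fun b hb => ?_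
    have hf0 : f ≠ 0 := by rintro rfl; simp at hb
    -- Since `deg f < deg Q`, the key polynomial property gives `δ(f) < δ(Q)`, which bounds every
    -- root of `f`.
    have h1 := mt (hQ.2 f hf0) (not_le.2 hf)
    rw [not_le] at h1
    have h2 : ((νbar (X - C b) : WithTop Γ') : WithBot (WithTop Γ')) ≤
        delta νbar (f.map (algebraMap K L)) := by
      unfold delta
      exact Finset.le_sup (f := fun a => ((νbar (X - C a) : WithTop Γ') : WithBot (WithTop Γ')))
        (Multiset.mem_toFinset.2 hb)
    have h3 : delta νbar (Q.map (algebraMap K L)) =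
        ((νbar (X - C a) : WithTop Γ') : WithBot (WithTop Γ')) := by
      rw [← hsup]; unfold delta; congr!
    rw [h3] at h1
    exact WithBot.coe_lt_coe.1 (h2.trans_lt h1)

/-- As `Q(a) = 0`, the product `f g` and its remainder take the same value at `a`; evaluation at `a`
preserves the valuation of `f`, of `g` and of the remainder. -/
theorem IsKeyPoly.preservedByMod [IsAlgClosed L] {ν : AddValuation K[X] (WithTop Γ)}
    {e : Γ →+ Γ'} (he : StrictMono e) {νbar : AddValuation L[X] (WithTop Γ')}
    (hνbar : ∀ f : K[X], νbar (f.map (algebraMap K L)) = (ν f).map e) {Q : K[X]}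
    (hQ : IsKeyPoly νbar Q) (hd : 0 < Q.degree) : PreservedByMod ν Q := by
  refine ⟨hd, fun f g hf hg => ?_⟩
  obtain ⟨a, ha, h⟩ := hQ.exists_root hd
  apply WithTop.map_injective he.injective
  rw [← hνbar, ← hνbar, ← h _ (EuclideanDomain.mod_lt _ (ne_zero_of_degree_gt hd)),
    Polynomial.map_mul, νbar.map_mul, ← h f hf, ← h g hg, ← νbar.map_mul, ← C_mul, ← map_mul]
  congr 2
  conv_rhs => rw [← EuclideanDomain.div_add_mod (f * g) Q]
  rw [map_add, map_mul, ha, zero_mul, zero_add]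

end KeyPolyTheory

/-! ### Initial forms and maps between graded rings. -/

section GradedTheory

variable {R Γ : Type*} [CommRing R] [AddCommGroup Γ] [LinearOrder Γ] [IsOrderedAddMonoid Γ]
  {v w u : AddValuation R (WithTop Γ)}

theorem Piece.mk_eq_zero {γ : Γ} {f : R} (hf : (γ : WithTop Γ) ≤ v f) :
    Piece.mk v f hf = 0 ↔ (γ : WithTop Γ) < v f := by
  rw [Piece.mk_zero, eq_comm, Piece.mk_eq_mk, sub_zero]

theorem of_mk_eq_inForm {γ : Γ} {f : R} (hf : v f = γ) :
    DirectSum.of (Piece v) γ (Piece.mk v f hf.ge) = inForm v f := by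
  have h : v f ≠ ⊤ := by rw [hf]; exact WithTop.coe_ne_top
  rw [inForm, dif_neg h]
  exact DirectSum.of_eq_of_gradedMonoid_eq (Piece.sigma_eq (by simp [hf]) rfl _ _)

/-- A homogeneous class of `f` in degree `γ` is `0` if `v f > γ` and is the initial form of `f`
otherwise. -/
theorem closure_range_inForm : AddSubgroup.closure (Set.range (inForm v)) = ⊤ := by
  refine eq_top_iff.2 fun z _ => ?_
  induction z using DirectSum.induction_on with
  | zero => exact zero_mem _
  | add a b ha hb => exact add_mem (ha trivial) (hb trivial)
  | of γ a =>
    obtain ⟨f, hf, rfl⟩ := a.exists_rep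
    rcases hf.lt_or_eq with h | h
    · rw [(Piece.mk_eq_zero hf).2 h, _root_.map_zero]
      exact zero_mem _
    · rw [of_mk_eq_inForm h.symm]
      exact AddSubgroup.subset_closure ⟨f, rfl⟩

theorem inForm_eq_of_lt {f g : R} (h : v f < v (g - f)) : inForm v f = inForm v g := by
  have hg : v g = v f := v.map_eq_of_lt_sub h
  obtain ⟨γ, hγ⟩ := WithTop.ne_top_iff_exists.1 (ne_top_of_lt h)
  rw [← of_mk_eq_inForm hγ.symm, ← of_mk_eq_inForm (hg.trans hγ.symm)]
  congr 1
  rw [Piece.mk_eq_mk, hγ]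
  exact h

theorem grMap_of (h : ∀ f, v f ≤ w f) (γ : Γ) (a : Piece v γ) :
    grMap h (DirectSum.of (Piece v) γ a) = DirectSum.of (Piece w) γ (pieceMap h γ a) := by
  rw [grMap, DirectSum.toSemiring_of]
  rfl

theorem grMap_apply (h : ∀ f, v f ≤ w f) (x : GrRing v) (γ : Γ) :
    (grMap h x) γ = pieceMap h γ (x γ) := by
  classical
  induction x using DirectSum.induction_on with
  | zero => simp
  | add a b ha hb => rw [map_add, DirectSum.add_apply, DirectSum.add_apply, map_add, ha, hb]
  | of β a =>
    rw [grMap_of]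
    by_cases hβ : β = γ
    · subst hβ
      rw [DirectSum.of_eq_same, DirectSum.of_eq_same]
    · rw [DirectSum.of_eq_of_ne _ _ _ (Ne.symm hβ), DirectSum.of_eq_of_ne _ _ _ (Ne.symm hβ),
        _root_.map_zero]

theorem grMap_self (h : ∀ f, v f ≤ v f) (x : GrRing v) : grMap h x = x := by
  refine DFinsupp.ext fun γ => ?_
  rw [grMap_apply]
  obtain ⟨f, hf, hx⟩ := (x γ).exists_rep
  rw [← hx, pieceMap_mk]

theorem grMap_grMap (h : ∀ f, v f ≤ w f) (h' : ∀ f, w f ≤ u f) (h'' : ∀ f, v f ≤ u f)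
    (x : GrRing v) : grMap h' (grMap h x) = grMap h'' x := by
  refine DFinsupp.ext fun γ => ?_
  rw [grMap_apply, grMap_apply, grMap_apply]
  obtain ⟨f, hf, hx⟩ := (x γ).exists_rep
  rw [← hx, pieceMap_mk, pieceMap_mk, pieceMap_mk]

/-- In a directed family of valuations below `u` such that the value of each `f` increases until it
reaches `u f`, each element of the kernel of `𝒢_{v i} → 𝒢_u` vanishes at a later stage. -/
theorem exists_grMap_eq_zero {ι : Type*} [Preorder ι] [IsDirectedOrder ι]
    {v : ι → AddValuation R (WithTop Γ)} (hv : ∀ i j, i ≤ j → ∀ f, v i f ≤ v j f)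
    (hu : ∀ i f, v i f ≤ u f) (hlt : ∀ i f, v i f < u f → ∃ j, i ≤ j ∧ v i f < v j f)
    {i : ι} {x : GrRing (v i)} (hx : grMap (hu i) x = 0) :
    ∃ j, ∃ hij : i ≤ j, grMap (hv i j hij) x = 0 := by
  classical
  have key : ∀ γ : Γ, ∃ j, ∀ k, j ≤ k → ∀ hik : i ≤ k, pieceMap (hv i k hik) γ (x γ) = 0 := by
    intro γ
    have h0 : pieceMap (hu i) γ (x γ) = 0 := by
      rw [← grMap_apply, hx]; rfl
    obtain ⟨f, hf, hxf⟩ := (x γ).exists_rep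
    rw [← hxf, pieceMap_mk, Piece.mk_eq_zero] at h0
    obtain ⟨j, hij, hj⟩ : ∃ j, i ≤ j ∧ (γ : WithTop Γ) < v j f := by
      rcases hf.lt_or_eq with h | h
      · exact ⟨i, le_rfl, h⟩
      · obtain ⟨j, hij, hj⟩ := hlt i f (h ▸ h0)
        exact ⟨j, hij, h ▸ hj⟩
    refine ⟨j, fun k hjk hik => ?_⟩
    rw [← hxf, pieceMap_mk, Piece.mk_eq_zero]
    exact hj.trans_le (hv j k hjk f)
  choose J hJ using key
  have : Nonempty ι := ⟨i⟩
  -- Only finitely many degrees occur in `x`, so directedness gives one index above `i` that works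
  -- for all of them.
  obtain ⟨k, hk⟩ := (insert i ((DFinsupp.support x).image J)).exists_le
  have hik : i ≤ k := hk i (Finset.mem_insert_self _ _)
  refine ⟨k, hik, DFinsupp.ext fun γ => ?_⟩
  rw [grMap_apply]
  by_cases hγ : γ ∈ DFinsupp.support x
  · exact hJ γ k (hk _ (Finset.mem_insert_of_mem (Finset.mem_image_of_mem J hγ))) hik
  · rw [DFinsupp.notMem_support_iff.1 hγ, _root_.map_zero]
    rfl

end GradedTheory

/-! ### The family `Ψ_n` and its limit key polynomial. -/

section LimitKeyPoly

variable {K L Γ Γ' : Type*} [Field K] [Field L] [Algebra K L]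
  [AddCommGroup Γ] [LinearOrder Γ] [IsOrderedAddMonoid Γ]
  [AddCommGroup Γ'] [LinearOrder Γ'] [IsOrderedAddMonoid Γ']
  {ν : AddValuation K[X] (WithTop Γ)} {νbar : AddValuation L[X] (WithTop Γ')} {n : ℕ} {Qn : K[X]}

theorem Psi.monic (Q : Psi ν νbar n) : Q.poly.Monic := Q.isKeyPoly.1

theorem Psi.degree_eq (Q : Psi ν νbar n) : Q.poly.degree = n := by
  rw [degree_eq_natDegree Q.monic.ne_zero, Q.natDegree_eq]

theorem Psi.degree_eq_degree (Q Q' : Psi ν νbar n) : Q.poly.degree = Q'.poly.degree := by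
  rw [Q.degree_eq, Q'.degree_eq]

/-- The only monic polynomial of degree `0` is `1`, so two distinct values exclude `n = 0`. -/
theorem Psi.degree_pos_of_lt {Q Q' : Psi ν νbar n} (h : ν Q.poly < ν Q'.poly) (P : Psi ν νbar n) :
    0 < P.poly.degree := by
  rw [← natDegree_pos_iff_degree_pos, P.natDegree_eq]
  refine Nat.pos_of_ne_zero fun h0 => h.ne ?_
  rw [Q.monic.natDegree_eq_zero.1 (Q.natDegree_eq.trans h0),
    Q'.monic.natDegree_eq_zero.1 (Q'.natDegree_eq.trans h0)]

theorem Psi.val_mono (w : ∀ Q : Psi ν νbar n, TruncVal ν Q.poly) {Q Q' : Psi ν νbar n}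
    (h : Q ≤ Q') (f : K[X]) : (w Q).val f ≤ (w Q').val f := by
  rw [(w Q).val_eq, (w Q').val_eq]
  exact h f

theorem Psi.le_of_map_le (w : ∀ Q : Psi ν νbar n, TruncVal ν Q.poly)
    (hpos : ∀ Q : Psi ν νbar n, 0 < Q.poly.degree) {Q Q' : Psi ν νbar n}
    (h : ν Q.poly ≤ ν Q'.poly) : Q ≤ Q' := fun f => by
  rw [← (w Q').val_eq]
  exact (w Q').truncation_le_of_map_le (hpos Q') Q.monic Q'.monic (Q.degree_eq_degree Q') h f

theorem Psi.isDirectedOrder (w : ∀ Q : Psi ν νbar n, TruncVal ν Q.poly)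
    (hpos : ∀ Q : Psi ν νbar n, 0 < Q.poly.degree) : IsDirectedOrder (Psi ν νbar n) := by
  refine ⟨fun Q Q' => ?_⟩
  rcases le_total (ν Q.poly) (ν Q'.poly) with h | h
  · exact ⟨Q', Psi.le_of_map_le w hpos h, le_rfl⟩
  · exact ⟨Q, le_rfl, Psi.le_of_map_le w hpos h⟩

theorem IsLimitKeyPoly.degree_le (hQn : IsLimitKeyPoly ν νbar n Qn)
    (hpos : ∀ Q : Psi ν νbar n, 0 < Q.poly.degree) (Q : Psi ν νbar n) :
    Q.poly.degree ≤ Qn.degree := by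
  by_contra! h
  exact (hQn.2.1 Q).ne (truncation_of_degree_lt (hpos Q) h)

theorem IsLimitKeyPoly.degree_pos [hne : Nonempty (Psi ν νbar n)]
    (hQn : IsLimitKeyPoly ν νbar n Qn) (hpos : ∀ Q : Psi ν νbar n, 0 < Q.poly.degree) :
    0 < Qn.degree :=
  (hpos hne.some).trans_le (hQn.degree_le hpos _)

/-- For a polynomial of degree less than `deg Qn`, the values `ν_Q f` are eventually `ν f`. -/
theorem IsLimitKeyPoly.exists_forall_val_eq (hQn : IsLimitKeyPoly ν νbar n Qn)
    (w : ∀ Q : Psi ν νbar n, TruncVal ν Q.poly) (hpos : ∀ Q : Psi ν νbar n, 0 < Q.poly.degree)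
    {f : K[X]} (hf : f.degree < Qn.degree) :
    ∃ Q : Psi ν νbar n, ∀ Q', Q ≤ Q' → (w Q').val f = ν f := by
  have h : f ∉ limitSet ν νbar n := fun h => absurd (hQn.2.2 f h) (not_le.2 hf)
  simp only [limitSet, Set.mem_ofPred_eq, not_forall, not_lt] at h
  obtain ⟨Q, hQ⟩ := h
  refine ⟨Q, fun Q' hQ' => le_antisymm ((w Q').le (hpos Q') f) (hQ.trans ?_)⟩
  rw [(w Q').val_eq]
  exact hQ' f

/-- Let `f g = c Qn + r`. If `ν (f g) ≠ ν r`, then `ν (c Qn)` is their minimum. For `Q` so late that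
`ν_Q` agrees with `ν` at `f`, `g` and `r`, this minimum bounds `ν_Q (c Qn)` from below, against
`ν_Q(Qn) < ν(Qn)`. -/
theorem IsLimitKeyPoly.preservedByMod [Nonempty (Psi ν νbar n)]
    (hQn : IsLimitKeyPoly ν νbar n Qn)
    (w : ∀ Q : Psi ν νbar n, TruncVal ν Q.poly) (hpos : ∀ Q : Psi ν νbar n, 0 < Q.poly.degree) :
    PreservedByMod ν Qn := by
  have hq := hQn.degree_pos hpos
  refine ⟨hq, fun f g hf hg => ?_⟩
  have := Psi.isDirectedOrder w hpos
  obtain ⟨Q₁, h₁⟩ := hQn.exists_forall_val_eq w hpos hf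
  obtain ⟨Q₂, h₂⟩ := hQn.exists_forall_val_eq w hpos hg
  obtain ⟨Q₃, h₃⟩ := hQn.exists_forall_val_eq w hpos
    (EuclideanDomain.mod_lt (f * g) (ne_zero_of_degree_gt hq))
  obtain ⟨Q₄, h₁₄, h₂₄⟩ := exists_ge_ge Q₁ Q₂
  obtain ⟨Q, h₄, h₃'⟩ := exists_ge_ge Q₄ Q₃
  by_contra hne
  have e : f * g / Qn * Qn = f * g + -(f * g % Qn) := by
    linear_combination EuclideanDomain.div_add_mod (f * g) Qn
  have hν : ν (f * g / Qn * Qn) = min (ν (f * g)) (ν (f * g % Qn)) := by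
    rw [e, ν.map_add_of_distinct_val (by rw [ν.map_neg]; exact Ne.symm hne), ν.map_neg]
  have hw : ν (f * g / Qn * Qn) ≤ (w Q).val (f * g / Qn * Qn) := by
    rw [hν, e]
    refine le_trans (le_of_eq ?_) ((w Q).val.map_add _ _)
    rw [(w Q).val.map_neg, h₃ Q h₃', (w Q).val.map_mul, h₁ Q (h₁₄.trans h₄), h₂ Q (h₂₄.trans h₄),
      ν.map_mul]
  -- Strictness survives multiplication by `c` only if `ν c` is finite; otherwise both `f g` and `r`
  -- would have value `∞`.
  have hc : ν (f * g / Qn) ≠ ⊤ := by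
    intro hc
    rw [ν.map_mul, hc, top_add] at hν
    have := min_eq_top.1 hν.symm
    exact hne (this.2.trans this.1.symm)
  refine absurd hw (not_le.2 ?_)
  rw [(w Q).val.map_mul, ν.map_mul]
  refine lt_of_le_of_lt (add_le_add ((w Q).le (hpos Q) _) le_rfl) (WithTop.add_lt_add_left hc ?_)
  rw [(w Q).val_eq]
  exact hQn.2.1 Q

theorem IsLimitKeyPoly.val_le (hQn : IsLimitKeyPoly ν νbar n Qn)
    (w : ∀ Q : Psi ν νbar n, TruncVal ν Q.poly) (hpos : ∀ Q : Psi ν νbar n, 0 < Q.poly.degree)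
    (wn : TruncVal ν Qn) (Q : Psi ν νbar n) (f : K[X]) : (w Q).val f ≤ wn.val f := by
  have hle := hQn.degree_le hpos Q
  have hq := (hpos Q).trans_le hle
  rw [(w Q).val_eq]
  rcases hle.lt_or_eq with hlt | heq
  · refine truncation_le_of_le (hpos Q) (fun f hf => ?_) ?_ f
    · rw [wn.map_of_degree_lt hq (hf.trans hlt)]
    · rw [wn.map_of_degree_lt hq hlt]
  · refine wn.truncation_le_of_map_le hq Q.monic hQn.1 heq ?_ f
    -- If `ν Qn < ν Q`, both terms of `Qn = Q + (Qn - Q)` have `ν_Q`-value at least `ν Qn`, so `Qn`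
    -- would not lie in the limit set.
    by_contra! hlt
    refine (hQn.2.1 Q).not_ge ?_
    rw [← (w Q).val_eq, ← add_sub_cancel Q.poly Qn]
    refine (w Q).val.map_le_add ?_ ?_
    · rw [add_sub_cancel, (w Q).map_self (hpos Q)]
      exact hlt.le
    · rw [add_sub_cancel,
        (w Q).map_of_degree_lt (hpos Q) (degree_sub_lt_of_monic hQn.1 Q.monic heq.symm)]
      exact ν.map_le_sub le_rfl hlt.le

theorem IsLimitKeyPoly.val_lt (hQn : IsLimitKeyPoly ν νbar n Qn)
    (w : ∀ Q : Psi ν νbar n, TruncVal ν Q.poly) (Q : Psi ν νbar n) : (w Q).val Qn < ν Qn := by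
  rw [(w Q).val_eq]
  exact hQn.2.1 Q

/-- If `ν_Q f = ν_{Qn} f`, then the initial form of `f` for `ν_{Qn}` is that of `f % Qn`. -/
theorem IsLimitKeyPoly.inForm_mem_R (hQn : IsLimitKeyPoly ν νbar n Qn)
    (w : ∀ Q : Psi ν νbar n, TruncVal ν Q.poly) (hpos : ∀ Q : Psi ν νbar n, 0 < Q.poly.degree)
    (wn : TruncVal ν Qn) {Q : Psi ν νbar n} {f : K[X]} (hf : (w Q).val f = wn.val f) :
    inForm wn.val f ∈ wn.R := by
  by_cases htop : wn.val f = ⊤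
  · rw [inForm, dif_pos htop]
    exact zero_mem _
  have hq := (hpos Q).trans_le (hQn.degree_le hpos Q)
  have := Psi.isDirectedOrder w hpos
  have hd := EuclideanDomain.mod_lt f (ne_zero_of_degree_gt hq)
  obtain ⟨Q₁, h₁⟩ := hQn.exists_forall_val_eq w hpos hd
  -- A later stage stabilizes the remainder and keeps `ν_Q f = ν_{Qn} f`, as `ν_{Q₂} f` lies between
  -- the two. Since `Qn` still has too small a value there, the multiple of `Qn` in `f` is
  -- negligible for `ν_{Qn}`.
  obtain ⟨Q₂, h, h₁'⟩ := exists_ge_ge Q Q₁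
  have hle := hQn.val_le w hpos wn Q₂
  have hlt := wn.lt_map_mul_div hq hle (by rw [wn.map_self hq]; exact hQn.val_lt w Q₂)
    (by rw [h₁ Q₂ h₁', wn.map_of_degree_lt hq hd])
    (le_antisymm (hle f) (hf.symm.le.trans (Psi.val_mono w h f))) htop
  have e : f % Qn - f = -(Qn * (f / Qn)) := by
    linear_combination EuclideanDomain.div_add_mod f Qn
  rw [inForm_eq_of_lt (g := f % Qn) (by rwa [e, wn.val.map_neg])]
  exact AddSubgroup.subset_closure ⟨_, hd, rfl⟩

/-- The values `ν_Q f` increase until they reach `ν_{Qn} f`. -/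
theorem IsLimitKeyPoly.exists_val_lt (hQn : IsLimitKeyPoly ν νbar n Qn)
    (w : ∀ Q : Psi ν νbar n, TruncVal ν Q.poly) (hpos : ∀ Q : Psi ν νbar n, 0 < Q.poly.degree)
    (hmax : ∀ Q : Psi ν νbar n, ∃ Q' : Psi ν νbar n, ν Q.poly < ν Q'.poly)
    (wn : TruncVal ν Qn) (Q : Psi ν νbar n) (f : K[X]) (hf : (w Q).val f < wn.val f) :
    ∃ Q', Q ≤ Q' ∧ (w Q).val f < (w Q').val f := by
  have hq := (hpos Q).trans_le (hQn.degree_le hpos Q)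
  have := Psi.isDirectedOrder w hpos
  have hd := EuclideanDomain.mod_lt f (ne_zero_of_degree_gt hq)
  obtain ⟨Q₁, h₁⟩ := hQn.exists_forall_val_eq w hpos hd
  obtain ⟨Q₂, h, h₁₂⟩ := exists_ge_ge Q Q₁
  obtain ⟨Q₃, hlt⟩ := hmax Q₂
  have h₂₃ : Q₂ ≤ Q₃ := Psi.le_of_map_le w hpos hlt.le
  have hr : (w Q).val f < ν (f % Qn) := by
    rw [← wn.map_of_degree_lt hq hd]
    exact hf.trans_le (wn.le_map_mod hq f)
  have hQ₂ : (w Q).val f ≤ (w Q₂).val (Qn * (f / Qn)) := by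
    have e : Qn * (f / Qn) = f - f % Qn := by
      linear_combination EuclideanDomain.div_add_mod f Qn
    rw [e]
    exact (w Q₂).val.map_le_sub (Psi.val_mono w h f) (by rw [h₁ Q₂ h₁₂]; exact hr.le)
  -- If the value of `Qn` stayed the same although `ν Q₂ < ν Q₃`, `TruncVal.eq_of_eq` would make it
  -- `ν Qn`.
  have hinc : (w Q₂).val Qn < (w Q₃).val Qn :=
    lt_of_le_of_ne (Psi.val_mono w h₂₃ Qn) fun heq => (hQn.val_lt w Q₂).ne
      ((w Q₂).eq_of_eq (w Q₃) (hpos Q₃) Q₂.monic Q₃.monic (Q₂.degree_eq_degree Q₃) hlt heq)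
  refine ⟨Q₃, h.trans h₂₃, ?_⟩
  rw [← EuclideanDomain.div_add_mod f Qn]
  conv_lhs => rw [EuclideanDomain.div_add_mod f Qn]
  -- Both terms of `f = Qn (f / Qn) + f % Qn` now exceed `ν_Q f`: the first because `Qn` has gained
  -- value, the second because it has its final value.
  refine (w Q₃).val.map_lt_add ?_ (by rwa [h₁ Q₃ (h₁₂.trans h₂₃)])
  rw [(w Q₃).val.map_mul]
  by_cases hg : (w Q₃).val (f / Qn) = ⊤
  · rw [hg, add_top]
    exact hf.trans_le le_top
  · refine hQ₂.trans_lt ?_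
    rw [(w Q₂).val.map_mul]
    exact lt_of_le_of_lt (add_le_add le_rfl (Psi.val_mono w h₂₃ _))
      (WithTop.add_lt_add_right hg hinc)

end LimitKeyPoly

end KeyPoly

end

/-! ### The isomorphism of the direct limit with `R_{Qn}`. -/

theorem mainTheorem3 {K L Γ Γ' : Type*} [Field K] [Field L] [Algebra K L] [IsAlgClosure K L]
    [AddCommGroup Γ] [LinearOrder Γ] [IsOrderedAddMonoid Γ]
    [AddCommGroup Γ'] [LinearOrder Γ'] [IsOrderedAddMonoid Γ']
    (ν : AddValuation K[X] (WithTop Γ))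
    -- an extension of `ν` to `L[x]`, with values in an ordered group that contains `Γ`
    (e : Γ →+ Γ') (he : StrictMono e) (νbar : AddValuation L[X] (WithTop Γ'))
    (hνbar : ∀ f : K[X], νbar (f.map (algebraMap K L)) = (ν f).map e)
    (n : ℕ) (hne : Nonempty (Psi ν νbar n))
    (hmax : ∀ Q : Psi ν νbar n, ∃ Q' : Psi ν νbar n, ν Q.poly < ν Q'.poly)
    (Qn : K[X]) (hQn : IsLimitKeyPoly ν νbar n Qn) :
    ∃ (w : ∀ Q : Psi ν νbar n, TruncVal ν Q.poly) (wn : TruncVal ν Qn),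
      IsDirectedOrder (Psi ν νbar n) ∧
      DirectedSystem (fun Q => (w Q).Gr) (fun Q Q' h => (w Q).phi (w Q') h) ∧
      ∃ S : Subring wn.Gr, S.toAddSubgroup = wn.R ∧
        Nonempty (Ring.DirectLimit (fun Q => (w Q).Gr)
          (fun Q Q' h => (w Q).phi (w Q') h) ≃+* S) := by
  have : IsAlgClosed L := IsAlgClosure.isAlgClosed K
  obtain ⟨Q', hQ'⟩ := hmax hne.some
  have hpos := Psi.degree_pos_of_lt hQ'
  let w : ∀ Q : Psi ν νbar n, TruncVal ν Q.poly := fun Q =>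
    (Q.isKeyPoly.preservedByMod he hνbar (hpos Q)).truncVal
  let wn : TruncVal ν Qn := (hQn.preservedByMod w hpos).truncVal
  have hdir := Psi.isDirectedOrder w hpos
  have hle := hQn.val_le w hpos wn
  have hsys : DirectedSystem (fun Q => (w Q).Gr) (fun Q Q' h => (w Q).phi (w Q') h) :=
    { map_self := fun Q x => grMap_self _ x
      map_map := fun Q₁ Q₂ Q₃ h h' x => grMap_grMap _ _ _ x }
  let F := Ring.DirectLimit.lift (fun Q => (w Q).Gr) (fun Q Q' h => (w Q).phi (w Q') h) wn.Gr
    (fun Q => grMap (hle Q)) (fun Q Q' h x => grMap_grMap _ _ _ x)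
  have hF : ∀ Q x, F (Ring.DirectLimit.of _ _ Q x) = grMap (hle Q) x := fun Q x =>
    Ring.DirectLimit.lift_of ..
  have hinj : Function.Injective F := by
    refine (injective_iff_map_eq_zero F).2 fun z hz => ?_
    obtain ⟨Q, x, rfl⟩ := Ring.DirectLimit.exists_of z
    rw [hF] at hz
    obtain ⟨Q', h, hx⟩ := exists_grMap_eq_zero (v := fun Q => (w Q).val)
      (fun Q Q' h => Psi.val_mono w h) hle (hQn.exists_val_lt w hpos hmax wn) hz
    -- In the limit, `x` is identified with its image at stage `Q'`, which is zero.
    rw [← Ring.DirectLimit.of_f h]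
    exact (congrArg _ hx).trans (_root_.map_zero _)
  have hrange : F.range.toAddSubgroup = wn.R := by
    apply le_antisymm
    · rintro _ ⟨z, rfl⟩
      obtain ⟨Q, x, rfl⟩ := Ring.DirectLimit.exists_of z
      change F _ ∈ wn.R
      rw [hF]
      have hx : x ∈ AddSubgroup.closure (Set.range (inForm (w Q).val)) := by
        rw [closure_range_inForm]; trivial
      induction hx using AddSubgroup.closure_induction with
      | mem x hx =>
        obtain ⟨f, rfl⟩ := hx
        rw [grMap_inForm]
        split_ifs with h
        · exact hQn.inForm_mem_R w hpos wn h
        · exact zero_mem _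
      | zero => rw [_root_.map_zero]; exact zero_mem _
      | add x y _ _ hx hy => rw [map_add]; exact add_mem hx hy
      | neg x _ hx => rw [map_neg]; exact neg_mem hx
    · refine (AddSubgroup.closure_le _).2 ?_
      rintro _ ⟨f, hf, rfl⟩
      obtain ⟨Q, hQ⟩ := hQn.exists_forall_val_eq w hpos hf
      refine ⟨Ring.DirectLimit.of _ _ Q (inForm (w Q).val f), ?_⟩
      change F _ = _
      rw [hF, grMap_inForm, if_pos]
      rw [hQ Q le_rfl, wn.map_of_degree_lt (hQn.degree_pos hpos) hf]
  -- That `R_{Qn}` is closed under multiplication comes for free: it is the range of a ring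
  -- homomorphism.
  exact ⟨w, wn, hdir, hsys, F.range, hrange,
    ⟨RingEquiv.ofBijective F.rangeRestrict
      ⟨fun a b h => hinj (congrArg Subtype.val h), F.rangeRestrict_surjective⟩⟩⟩
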